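/- Let $F$ be a global function field with full constant field $\mathbb F_q$ having $n\ge 1$ rational places, let $P_1,\dots,P_n$ be all its rational places, let $t_i$ be a local parameter of $F$ at $P_i$, let $h$ be the class number of $F$, and let $m\ge 1$ and $r\ge s\ge 0$ be integers. A divisor $D$ is called positive if all its coefficients are $\ge 0$ (so $D=0$ is allowed). For a positive divisor $D$ put $\overline D=\sum_{i=1}^n\min(m+1,v_{P_i}(D))\,P_i$, let $j_l(D)=|\{i: v_{P_i}(D)=m-l\}|$ for $0\le l\le m$, and $J_m(D)=\sum_{l=1}^m (l+1)j_l(D)$. For nonnegative integers $X_1,\dots,X_m$ consider the conditions $$\text{(2)}\quad j_l(D)\le 2X_l+\sum_{\nu=l+1}^m X_\nu\quad(1\le l\le m),\qquad \text{(3)}\quad J_m(D)\le 2\sum_{l=1}^m (l+1)X_l ,$$ and let $\mathcal V_m(r,s;X_1,\dots,X_m)$ be the set of positive divisors $D$ with $\deg D=r$, $\deg\overline D\ge s$ that satisfy (2) and (3). Assume that $$|\mathcal V_m(r,s;0,\dots,0)|<h .$$ Then there is a divisor $G$ of $F$ with the following property: $(*)$ $\deg G=r$, $\operatorname{supp}(G)\cap\{P_1,\dots,P_n\}=\emptyset$,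 and for each nonzero $f\in\mathcal L(G)$ whose zero divisor $E=(f)_0$ satisfies (2) and (3) with $X_1=\dots=X_m=0$, one has $\deg\overline E\le s-1$. Let $G$ be any divisor with property $(*)$. For $f\in\mathcal L(G)$ let $f=\sum_{l\ge 0}f^{(l)}(P_i)\,t_i^l$ be its local expansion at $P_i$, with coefficients in $\mathbb F_q$, and define the $\mathbb F_q$-linear maps $$\Phi:\mathcal L(G)\to\mathbb F_q^{mn},\quad f\mapsto\big(f^{(m-1)}(P_i),\dots,f^{(1)}(P_i),f^{(0)}(P_i)\big)_{1\le i\le n},\qquad \psi:\mathcal L(G)\to\mathbb F_q^n,\quad f\mapsto\big(f^{(m)}(P_1),\dots,f^{(m)}(P_n)\big).$$ Assume that $|\mathcal L(G)|>q^{mn}$ and $(m+1)n\ge s$. Then $\operatorname{Ker}\Phi=\mathcal L\big(G-m(P_1+\dots+P_n)\big)$, and $C=\psi(\operatorname{Ker}\Phi)$ is a linear code over $\mathbb F_q$ of length $n$ whose dimension and minimum distance satisfy $$\dim C\ge\dim\mathcal L(G)-mn,\qquad d(C)\ge (m+1)n+1-s .$$ -/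

import Mathlib

namespace AGCode

open Module

noncomputable section

section FunctionFields

/-- A place of `F / k`, given by its normalized discrete valuation: a valuation of `F` with value
group `ℤ` (written multiplicatively, so that `val f = exp (-v_P(f))`) that is trivial on `k`.
Distinct places have distinct normalized valuations, and conversely. -/
@[ext]
structure Place (k F : Type*) [Field k] [Field F] [Algebra k F] where
  val : Valuation F (WithZero (Multiplicative ℤ))
  surjective : Function.Surjective val
  isTrivialOn : val.IsTrivialOn k

variable {k F : Type*} [Field k] [Field F] [Algebra k F]

namespace Place

/-- The additive value `v_P(f) ∈ ℤ` of a nonzero `f` (the value at `f = 0` is never used). -/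
def ord (P : Place k F) (f : F) : ℤ := -WithZero.log (P.val f)

/-- The valuation ring `O_P = {f : v_P(f) ≥ 0}`. -/
abbrev ring (P : Place k F) : ValuationSubring F := P.val.valuationSubring

theorem algebraMap_mem (P : Place k F) (a : k) : algebraMap k F a ∈ P.ring := by
  rw [Valuation.mem_valuationSubring_iff]
  by_cases ha : a = 0
  · simp [ha]
  · exact (P.isTrivialOn.eq_one a ha).le

instance (P : Place k F) : Algebra k P.ring :=
  ((algebraMap k F).codRestrict P.ring P.algebraMap_mem).toAlgebra

theorem coe_algebraMap (P : Place k F) (a : k) :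
    ((algebraMap k P.ring a : P.ring) : F) = algebraMap k F a := rfl

theorem coe_smul (P : Place k F) (a : k) (f : P.ring) : ((a • f : P.ring) : F) = a • (f : F) := by
  rw [Algebra.smul_def, Algebra.smul_def]; rfl

/-- The degree of `P`: the degree over `k` of its residue class field. -/
def degree (P : Place k F) : ℕ := finrank k (IsLocalRing.ResidueField P.ring)

/-- A rational place is a place of degree one. -/
def IsRational (P : Place k F) : Prop := P.degree = 1

/-- `t` is a local parameter at `P`. -/
def IsLocalParameter (P : Place k F) (t : F) : Prop := P.ord t = 1

theorem IsLocalParameter.val_eq {P : Place k F} {t : F} (ht : P.IsLocalParameter t) :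
    P.val t = WithZero.exp (-1 : ℤ) := by
  have h1 : WithZero.log (P.val t) = -1 := by
    have : -WithZero.log (P.val t) = 1 := ht
    omega
  have h0 : P.val t ≠ 0 := fun h => by simp [h] at h1
  rw [← h1, WithZero.exp_log h0]

theorem IsLocalParameter.ne_zero {P : Place k F} {t : F} (ht : P.IsLocalParameter t) : t ≠ 0 := by
  rintro rfl
  have h := ht.val_eq
  rw [map_zero] at h
  exact WithZero.exp_ne_zero h.symm

/-- At a rational place, the constants are identified with the residue class field. -/
def residueEquiv (P : Place k F) (hP : P.IsRational) :
    k ≃ₐ[k] IsLocalRing.ResidueField P.ring :=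
  AlgEquiv.ofBijective (Algebra.ofId k _) (Algebra.finrank_eq_one_iff_bijective_algebraMap.mp hP)

/-- The value `f(P) ∈ k` of a function `f` that is regular at the rational place `P`: its residue
class, as an element of `k`. -/
def value (P : Place k F) (hP : P.IsRational) : P.ring →ₐ[k] k :=
  ((P.residueEquiv hP).symm : IsLocalRing.ResidueField P.ring →ₐ[k] k).comp
    (IsScalarTower.toAlgHom k P.ring (IsLocalRing.ResidueField P.ring))

theorem val_sub_value_lt_one (P : Place k F) (hP : P.IsRational) (f : P.ring) :
    P.val ((f : F) - algebraMap k F (P.value hP f)) < 1 := by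
  have key : f - algebraMap k P.ring (P.value hP f) ∈ IsLocalRing.maximalIdeal P.ring := by
    rw [← IsLocalRing.residue_eq_zero_iff, map_sub, sub_eq_zero]
    exact ((P.residueEquiv hP).apply_symm_apply (IsLocalRing.residue P.ring f)).symm
  exact (Valuation.mem_maximalIdeal_iff (v := P.val)).mp key

/-- For `f ∈ O_P` the function `(f - f(P)) / t` is again in `O_P`. -/
theorem sub_value_div_mem (P : Place k F) (hP : P.IsRational) {t : F} (ht : P.IsLocalParameter t)
    (f : P.ring) : ((f : F) - algebraMap k F (P.value hP f)) / t ∈ P.ring := by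
  rw [Valuation.mem_valuationSubring_iff, map_div₀, ht.val_eq]
  have h := P.val_sub_value_lt_one hP f
  by_cases h0 : P.val ((f : F) - algebraMap k F (P.value hP f)) = 0
  · simp [h0]
  · rw [div_le_one₀ (by simp), ← WithZero.log_le_iff_le_exp h0]
    rw [← WithZero.exp_zero, ← WithZero.log_lt_iff_lt_exp h0] at h
    omega

/-- The linear map `f ↦ (f - f(P)) / t` of `O_P`; it removes the constant term from the expansion
in powers of `t` and shifts the other coefficients. -/
def shift (P : Place k F) (hP : P.IsRational) {t : F} (ht : P.IsLocalParameter t) :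
    P.ring →ₗ[k] P.ring where
  toFun f := ⟨((f : F) - algebraMap k F (P.value hP f)) / t, P.sub_value_div_mem hP ht f⟩
  map_add' f g := by
    apply Subtype.ext
    change ((f : F) + g - algebraMap k F (P.value hP (f + g))) / t =
      ((f : F) - algebraMap k F (P.value hP f)) / t + ((g : F) - algebraMap k F (P.value hP g)) / t
    rw [map_add, map_add]
    ring
  map_smul' a f := by
    apply Subtype.ext
    change (((a • f : P.ring) : F) - algebraMap k F (P.value hP (a • f))) / t =
      ((a • (⟨((f : F) - algebraMap k F (P.value hP f)) / t,
        P.sub_value_div_mem hP ht f⟩ : P.ring) : P.ring) : F)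
    rw [coe_smul, coe_smul, map_smul, smul_eq_mul, map_mul, Algebra.smul_def, Algebra.smul_def]
    ring

/-- The coefficient `f^{(l)}(P)` of `t ^ l` in the local expansion `f = ∑ f^{(l)}(P) t ^ l` of
`f ∈ O_P` at the rational place `P`; see `val_sub_sum_expansionCoeff_le` and
`expansionCoeff_unique`. -/
def expansionCoeff (P : Place k F) (hP : P.IsRational) {t : F} (ht : P.IsLocalParameter t)
    (l : ℕ) : P.ring →ₗ[k] k :=
  (P.value hP).toLinearMap ∘ₗ (P.shift hP ht) ^ l

theorem eq_value_add_mul_shift (P : Place k F) (hP : P.IsRational) {t : F}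
    (ht : P.IsLocalParameter t) (f : P.ring) :
    (f : F) = algebraMap k F (P.value hP f) + t * (P.shift hP ht f : F) := by
  have h0 := ht.ne_zero
  change _ = _ + t * (((f : F) - algebraMap k F (P.value hP f)) / t)
  field_simp
  ring

theorem eq_sum_expansionCoeff_add (P : Place k F) (hP : P.IsRational) {t : F}
    (ht : P.IsLocalParameter t) (f : P.ring) (N : ℕ) :
    (f : F) = ∑ l ∈ Finset.range N, algebraMap k F (P.expansionCoeff hP ht l f) * t ^ l
      + t ^ N * (((P.shift hP ht) ^ N) f : P.ring) := by
  induction N with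
  | zero => simp
  | succ N ih =>
    rw [Finset.sum_range_succ, pow_succ' (P.shift hP ht) N, Module.End.mul_apply]
    have h := P.eq_value_add_mul_shift hP ht (((P.shift hP ht) ^ N) f)
    have hc : P.expansionCoeff hP ht N f = P.value hP (((P.shift hP ht) ^ N) f) := rfl
    rw [hc]
    calc (f : F) = _ := ih
      _ = _ := by rw [h]; ring

/-- The partial sums of the local expansion converge to `f`: the `N`-th remainder has
`P`-value at least `N`. -/
theorem val_sub_sum_expansionCoeff_le (P : Place k F) (hP : P.IsRational) {t : F}
    (ht : P.IsLocalParameter t) (f : P.ring) (N : ℕ) :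
    P.val ((f : F) - ∑ l ∈ Finset.range N, algebraMap k F (P.expansionCoeff hP ht l f) * t ^ l)
      ≤ WithZero.exp (-(N : ℤ)) := by
  rw [sub_eq_of_eq_add' (P.eq_sum_expansionCoeff_add hP ht f N), map_mul, map_pow, ht.val_eq,
    ← WithZero.exp_nsmul]
  refine (mul_le_of_le_one_right zero_le (((P.shift hP ht) ^ N) f).2).trans ?_
  simp

/-- The coefficients of the local expansion are determined by the convergence of its partial
sums. -/
theorem expansionCoeff_unique (P : Place k F) (hP : P.IsRational) {t : F}
    (ht : P.IsLocalParameter t) (f : P.ring) (c : ℕ → k)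
    (hc : ∀ N : ℕ, P.val ((f : F) - ∑ l ∈ Finset.range N, algebraMap k F (c l) * t ^ l)
      ≤ WithZero.exp (-(N : ℤ))) (N : ℕ) : c N = P.expansionCoeff hP ht N f := by
  induction N using Nat.strong_induction_on with
  | _ N ih =>
    by_contra hne
    have h1 := hc (N + 1)
    have h2 := P.val_sub_sum_expansionCoeff_le hP ht f (N + 1)
    have h3 := (P.val.map_sub _ _).trans (max_le h2 h1)
    have hs : ∑ l ∈ Finset.range N, algebraMap k F (c l) * t ^ l =
        ∑ l ∈ Finset.range N, algebraMap k F (P.expansionCoeff hP ht l f) * t ^ l :=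
      Finset.sum_congr rfl fun l hl => by rw [ih l (Finset.mem_range.mp hl)]
    rw [Finset.sum_range_succ, Finset.sum_range_succ, hs] at h3
    have e : ∀ x S y z : F, x - (S + y * z) - (x - (S + c N • z)) = (c N • (1 : F) - y) * z := by
      intro x S y z
      rw [Algebra.smul_def, Algebra.smul_def]
      ring
    rw [← Algebra.smul_def (c N), e, Algebra.smul_def, mul_one, ← map_sub, map_mul, map_pow,
      ht.val_eq, P.isTrivialOn.eq_one _ (sub_ne_zero.mpr hne), one_mul, ← WithZero.exp_nsmul,
      WithZero.exp_le_exp] at h3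
    simp at h3

end Place

/-- The divisors of `F`. -/
abbrev Divisor (k F : Type*) [Field k] [Field F] [Algebra k F] : Type _ := Place k F →₀ ℤ

namespace Divisor

/-- The degree of a divisor, `∑ v_P(D) deg P`. -/
def deg : Divisor k F →+ ℤ :=
  (Finsupp.linearCombination ℤ (fun P : Place k F => (P.degree : ℤ))).toAddMonoidHom

/-- The divisors of degree zero. -/
def degZero (k F : Type*) [Field k] [Field F] [Algebra k F] : AddSubgroup (Divisor k F) :=
  (deg (k := k) (F := F)).ker

/-- The group of principal divisors `(f) = ∑ v_P(f) P`, `f ≠ 0`. -/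
def principal (k F : Type*) [Field k] [Field F] [Algebra k F] : AddSubgroup (Divisor k F) where
  carrier := {D | ∃ f : F, f ≠ 0 ∧ ∀ P : Place k F, D P = P.ord f}
  zero_mem' := ⟨1, one_ne_zero, fun P => by simp [Place.ord]⟩
  add_mem' := by
    rintro D E ⟨f, hf, hD⟩ ⟨g, hg, hE⟩
    refine ⟨f * g, mul_ne_zero hf hg, fun P => ?_⟩
    have h1 : P.val f ≠ 0 := (Valuation.ne_zero_iff _).mpr hf
    have h2 : P.val g ≠ 0 := (Valuation.ne_zero_iff _).mpr hg
    rw [Finsupp.add_apply, hD, hE, Place.ord, Place.ord, Place.ord, map_mul,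
      WithZero.log_mul h1 h2]
    ring
  neg_mem' := by
    rintro D ⟨f, hf, hD⟩
    refine ⟨f⁻¹, inv_ne_zero hf, fun P => ?_⟩
    rw [Finsupp.neg_apply, hD, Place.ord, Place.ord, map_inv₀, WithZero.log_inv]

/-- The class number `h`: the number of classes of divisors of degree zero modulo principal
divisors. -/
def classNumber (k F : Type*) [Field k] [Field F] [Algebra k F] : ℕ∞ :=
  ENat.card (degZero k F ⧸ (principal k F).addSubgroupOf (degZero k F))

/-- The Riemann-Roch space `L(G) = {f : v_P(f) ≥ -v_P(G) for all P}`; see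
`mem_riemannRoch_iff`. -/
def riemannRoch (G : Divisor k F) : Submodule k F where
  carrier := {f | ∀ P : Place k F, P.val f ≤ WithZero.exp (G P)}
  zero_mem' := fun P => by simp
  add_mem' := fun hf hg P => (P.val.map_add _ _).trans (max_le (hf P) (hg P))
  smul_mem' := fun a f hf P => by
    rw [Algebra.smul_def, map_mul]
    exact (mul_le_of_le_one_left zero_le (P.algebraMap_mem a)).trans (hf P)

theorem mem_riemannRoch_iff (G : Divisor k F) (f : F) :
    f ∈ riemannRoch G ↔ f = 0 ∨ ∀ P : Place k F, -(G P) ≤ P.ord f := by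
  by_cases hf : f = 0
  · simp [hf]
  · simp only [hf, false_or]
    refine forall_congr' fun P => ?_
    rw [← WithZero.log_le_iff_le_exp ((Valuation.ne_zero_iff _).mpr hf), Place.ord, neg_le_neg_iff]

theorem mem_ring_of_mem_riemannRoch {G : Divisor k F} {P : Place k F} (hG : G P = 0) {f : F}
    (hf : f ∈ riemannRoch G) : f ∈ P.ring := by
  have h := hf P
  rwa [hG, WithZero.exp_zero] at h

/-- The inclusion of `L(G)` in `O_P` when `P` is not in the support of `G`. -/
def toRing (G : Divisor k F) (P : Place k F) (hG : G P = 0) : riemannRoch G →ₗ[k] P.ring where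
  toFun f := ⟨f, mem_ring_of_mem_riemannRoch hG f.2⟩
  map_add' _ _ := rfl
  map_smul' a f := Subtype.ext (P.coe_smul a ⟨f, mem_ring_of_mem_riemannRoch hG f.2⟩).symm

end Divisor

/-- The rational places of `F`. -/
abbrev RationalPlace (k F : Type*) [Field k] [Field F] [Algebra k F] : Type _ :=
  {P : Place k F // P.IsRational}

/-! In the following, `P` enumerates all the rational places `P_1, …, P_n`. The quantities depend
only on the coefficients `v_{P_i}(D)` of a divisor `D ≥ 0`, so they are written for a function
`D : Place k F → ℤ` of coefficients; a divisor is used as such a function through the coercion. -/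

/-- The coefficients of the zero divisor `(f)_0` of `f ≠ 0`. -/
def zeroDivisor (f : F) (Q : Place k F) : ℤ := max (Q.ord f) 0

variable {n : ℕ} (P : Fin n ≃ RationalPlace k F) (m : ℕ)

/-- The divisor `D̄ = a_1 P_1 + ⋯ + a_n P_n` with `a_i = min (m + 1, v_{P_i}(D))`. -/
def restrictDivisor (D : Place k F → ℤ) : Divisor k F :=
  ∑ i, Finsupp.single (P i : Place k F) (min ((m : ℤ) + 1) (D (P i)))

/-- `j_l(D)`, the number of `i` with `v_{P_i}(D) = m - l`. -/
def jCount (D : Place k F → ℤ) (l : ℕ) : ℕ :=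
  Nat.card {i : Fin n // D (P i) = (m : ℤ) - l}

/-- `J_m(D) = 2 j_1(D) + 3 j_2(D) + ⋯ + (m + 1) j_m(D)`. -/
def jWeight (D : Place k F → ℤ) : ℕ := ∑ l ∈ Finset.Icc 1 m, (l + 1) * jCount P m D l

/-- The condition `j_l(D) ≤ 2 X_l + (X_{l+1} + ⋯ + X_m)` for `1 ≤ l ≤ m`. -/
def CountCondition (X : ℕ → ℕ) (D : Place k F → ℤ) : Prop :=
  ∀ l ∈ Finset.Icc 1 m, jCount P m D l ≤ 2 * X l + ∑ ν ∈ Finset.Icc (l + 1) m, X ν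

/-- The condition `J_m(D) ≤ 2 (2 X_1 + 3 X_2 + ⋯ + (m + 1) X_m)`. -/
def WeightCondition (X : ℕ → ℕ) (D : Place k F → ℤ) : Prop :=
  jWeight P m D ≤ 2 * ∑ l ∈ Finset.Icc 1 m, (l + 1) * X l

/-- The set `V_m(r, s; X_1, …, X_m)` of positive (that is, effective) divisors. -/
def divisorSet (r s : ℕ) (X : ℕ → ℕ) : Set (Divisor k F) :=
  {D | 0 ≤ D ∧ Divisor.deg D = r ∧ (s : ℤ) ≤ Divisor.deg (restrictDivisor P m D) ∧
    CountCondition P m X D ∧ WeightCondition P m X D}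

/-- The properties that single out the divisor `G` used in the construction: it has degree `r`,
its support contains no rational place, and `deg Ē ≤ s - 1` for the zero divisor `E` of each
nonzero `f ∈ L(G)` for which `E` satisfies the two conditions on the numbers `j_l(E)`. -/
structure IsDistinguished (r s : ℕ) (X : ℕ → ℕ) (G : Divisor k F) : Prop where
  deg_eq : Divisor.deg G = r
  apply_eq_zero : ∀ i, G (P i) = 0
  deg_restrict_le : ∀ f ∈ Divisor.riemannRoch G, f ≠ 0 →
    CountCondition P m X (zeroDivisor f) → WeightCondition P m X (zeroDivisor f) →
    Divisor.deg (restrictDivisor P m (zeroDivisor f)) ≤ (s : ℤ) - 1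

variable {t : Fin n → F} (ht : ∀ i, (P i : Place k F).IsLocalParameter (t i))
  (G : Divisor k F) (hG : ∀ i, G (P i) = 0)

/-- The map `f ↦ f^{(l)}(P_i)` on `L(G)`. -/
def localCoeff (i : Fin n) (l : ℕ) : Divisor.riemannRoch G →ₗ[k] k :=
  (P i : Place k F).expansionCoeff (P i).2 (ht i) l ∘ₗ G.toRing (P i) (hG i)

/-- The map `Φ : L(G) → k^{mn}`, `f ↦ (φ_1(f), …, φ_n(f))`, where
`φ_i(f) = (f^{(m-1)}(P_i), …, f^{(1)}(P_i), f^{(0)}(P_i))`. -/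
def Phi : Divisor.riemannRoch G →ₗ[k] (Fin n → Fin m → k) :=
  LinearMap.pi fun i => LinearMap.pi fun j => localCoeff P ht G hG i (Fin.rev j)

/-- The map `ψ : L(G) → k^n`, `f ↦ (f^{(m)}(P_1), …, f^{(m)}(P_n))`. -/
def psi : Divisor.riemannRoch G →ₗ[k] (Fin n → k) :=
  LinearMap.pi fun i => localCoeff P ht G hG i m

/-- The linear code `C = ψ(Ker Φ)` of length `n`. -/
def code : Submodule k (Fin n → k) :=
  (LinearMap.ker (Phi P m ht G hG)).map (psi P m ht G hG)

end FunctionFields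

open Classical in
/-- The minimum distance of a code `C` of length `n`, the least Hamming distance of two distinct
codewords (and `0` if there are no two distinct codewords). -/
def minDist {k : Type*} {n : ℕ} (C : Set (Fin n → k)) : ℕ :=
  sInf {d | ∃ x ∈ C, ∃ y ∈ C, x ≠ y ∧ hammingDist x y = d}

end

end AGCode

/-!
The existence of `G` is a counting argument in the group of divisor classes. Adding a fixed divisor
of degree `r` identifies the classes of degree zero with those of degree `r`, so the hypothesis
`|V_m(r, s; 0, …, 0)| < h` leaves a class of degree `r` that contains no element of
`V_m(r, s; 0, …, 0)`; by weak approximation (`Place.exists_forall_ord_eq`) the class has a member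
`G` whose support avoids the rational places. A nonzero `f ∈ L(G)` that violated the required bound
would make `G + (f)` an element of `V_m(r, s; 0, …, 0)` in that class (`exists_isDistinguished`).

This argument uses that the divisor of a nonzero function is finite and of degree zero
(`exists_divisor_of_functionField`). For a separating element `z` the integral closure of `k[z]` in
`F` is a finite free `k[z]`-module of rank `[F : k(z)]`, its maximal ideals correspond to the places
regular on it, and the fundamental identity `∑ e f = [F : k(z)]` over the prime `(z)` says that the
zero divisor of `z` has degree `[F : k(z)]` (`exists_finset_zeros`). The same holds for `1 / z`, and
`k(1 / z) = k(z)`, so `(z)` has degree zero. If `y` is separating and `f ≠ 0`, then `f` or `f y` is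
separating (`isSeparable_or_isSeparable_mul`), because the derivations of `F / k` form a space of
dimension at most one; this covers every `f`, and `y` exists because `k` is perfect.

For the code, `Ker Φ` consists of the `f ∈ L(G)` that vanish to order at least `m` at every `P_i`.
For such `f ≠ 0` with zero divisor `E` all the numbers `j_1(E), …, j_m(E)` are zero, so
`deg Ē ≤ s - 1`, whereas `deg Ē` is at least `m n` plus the number of zero coordinates of `ψ(f)`.
This bounds the weight of `ψ(f)` below by `(m + 1) n + 1 - s ≥ 1` (`le_hammingNorm_psi`). Hence `ψ`
is injective on `Ker Φ`, the dimension of the code is that of `Ker Φ`, and the bound on the minimum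
distance follows.
-/

open WithZero IsDedekindDomain Module
open scoped IntermediateField

/-! ### Two facts on fields -/

/-- A surjective `ℤᵐ⁰`-valued valuation is determined by its valuation ring, and comparable
valuation rings of this kind are equal. -/
theorem Valuation.eq_of_le_one_imp_le_one {F : Type*} [Field F]
    {v w : Valuation F (WithZero (Multiplicative ℤ))} (hv : Function.Surjective v)
    (hw : Function.Surjective w) (h : ∀ f, v f ≤ 1 → w f ≤ 1) : v = w := by
  obtain ⟨π, hπ⟩ := hv (exp (-1))
  have hone (f : F) (hf : v f = 1) : w f = 1 := by
    refine le_antisymm (h f hf.le) ?_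
    have h1 := h f⁻¹ (by simp [hf])
    rw [map_inv₀] at h1
    have h0 : w f ≠ 0 := (Valuation.ne_zero_iff _).mpr (by rintro rfl; simp at hf)
    exact (inv_le_one₀ (zero_lt_iff.mpr h0)).mp h1
  have hπ0 : π ≠ 0 := by
    rintro rfl
    exact exp_ne_zero (hπ.symm.trans (map_zero v))
  have hwπ0 : w π ≠ 0 := (Valuation.ne_zero_iff _).mpr hπ0
  have hwπ : log (w π) ≤ 0 := by
    have := h π (by rw [hπ, ← exp_zero, exp_le_exp]; omega)
    rw [← exp_zero] at this
    exact (log_le_iff_le_exp hwπ0).mpr this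
  have key (f : F) (hf : f ≠ 0) : w f = w π ^ (-log (v f)) := by
    have hvf : v f ≠ 0 := (Valuation.ne_zero_iff _).mpr hf
    have h1 : v (f / π ^ (-log (v f))) = 1 := by
      rw [map_div₀, map_zpow₀, hπ, ← exp_zsmul]
      simp [exp_log hvf, div_self hvf]
    have h2 := hone _ h1
    rw [map_div₀, map_zpow₀, div_eq_one_iff_eq (zpow_ne_zero _ hwπ0)] at h2
    exact h2
  obtain ⟨g, hg⟩ := hw (exp (-1))
  have hg0 : g ≠ 0 := by
    rintro rfl
    exact exp_ne_zero (hg.symm.trans (map_zero w))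
  have h1 : log (w π) = -1 := by
    have h2 := congrArg log (key g hg0)
    rw [hg, log_exp, log_zpow, smul_eq_mul] at h2
    have h3 : log (w π) ∣ 1 := ⟨log (v g), by linarith⟩
    rcases Int.isUnit_iff.mp (isUnit_of_dvd_one h3) with h4 | h4 <;> omega
  ext f
  by_cases hf : f = 0
  · simp [hf]
  have hvf : v f ≠ 0 := (Valuation.ne_zero_iff _).mpr hf
  rw [key f hf, ← exp_log hwπ0, h1, ← exp_zsmul]
  simp [exp_log hvf]

/-- A nonzero differential is detected by a linear functional, which is a derivation. -/
theorem Algebra.FormallyUnramified.of_forall_derivation_eq_zero {K L : Type*} [Field K] [Field L]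
    [Algebra K L] (h : ∀ D : Derivation K L L, D = 0) : Algebra.FormallyUnramified K L := by
  refine ⟨⟨fun ω ω' => ?_⟩⟩
  rw [← sub_eq_zero, ← Module.forall_dual_apply_eq_zero_iff L]
  intro φ
  have : φ = 0 := by
    refine Derivation.liftKaehlerDifferential_unique φ 0 ?_
    rw [h (φ.compDer _), h (LinearMap.compDer 0 _)]
  rw [this, LinearMap.zero_apply]

namespace AGCode

variable {k F : Type*} [Field k] [Field F] [Algebra k F]

/-! ### Places and maximal ideals of a Dedekind domain -/

namespace Place

theorem eq_of_le_one_imp_le_one {P Q : Place k F} (h : ∀ f, P.val f ≤ 1 → Q.val f ≤ 1) : P = Q :=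
  Place.ext (Valuation.eq_of_le_one_imp_le_one P.surjective Q.surjective h)

theorem val_ne_zero (P : Place k F) {f : F} (hf : f ≠ 0) : P.val f ≠ 0 :=
  (Valuation.ne_zero_iff _).mpr hf

theorem val_eq_exp (P : Place k F) {f : F} (hf : f ≠ 0) : P.val f = exp (-P.ord f) := by
  rw [ord, neg_neg, exp_log (P.val_ne_zero hf)]

theorem le_ord_iff (P : Place k F) {f : F} (hf : f ≠ 0) (a : ℤ) :
    a ≤ P.ord f ↔ P.val f ≤ exp (-a) := by
  rw [P.val_eq_exp hf, exp_le_exp, neg_le_neg_iff]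

theorem ord_mul (P : Place k F) {f g : F} (hf : f ≠ 0) (hg : g ≠ 0) :
    P.ord (f * g) = P.ord f + P.ord g := by
  rw [ord, ord, ord, map_mul, log_mul (P.val_ne_zero hf) (P.val_ne_zero hg)]
  ring

theorem ord_inv (P : Place k F) (f : F) : P.ord f⁻¹ = -P.ord f := by
  rw [ord, ord, map_inv₀, log_inv]

theorem ord_pos_iff (P : Place k F) {f : F} (hf : f ≠ 0) : 0 < P.ord f ↔ P.val f < 1 := by
  rw [P.val_eq_exp hf, ← exp_zero, exp_lt_exp, neg_lt_zero]

section HeightOneSpectrum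

variable {B : Type*} [CommRing B] [IsDedekindDomain B] [Algebra B F] [IsFractionRing B F]
  [Algebra k B] [IsScalarTower k B F]

variable (k F) in
/-- The place attached to a maximal ideal of a Dedekind domain with field of fractions `F`. -/
@[simps] noncomputable def ofHeightOneSpectrum (p : HeightOneSpectrum B) : Place k F where
  val := p.valuation F
  surjective := p.valuation_surjective F
  isTrivialOn := ⟨fun a ha => by
    rw [IsScalarTower.algebraMap_apply k B F, HeightOneSpectrum.valuation_eq_one_iff_notMem]
    exact fun h => p.isPrime.ne_top (Ideal.eq_top_of_isUnit_mem _ h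
      ((isUnit_iff_ne_zero.mpr ha).map (algebraMap k B)))⟩

theorem ofHeightOneSpectrum_injective :
    Function.Injective (ofHeightOneSpectrum k F (B := B)) := by
  intro p q h
  ext b
  rw [← p.valuation_lt_one_iff_mem (K := F), ← q.valuation_lt_one_iff_mem (K := F)]
  exact iff_of_eq (congrArg (fun P : Place k F => P.val (algebraMap B F b) < 1) h)

/-- A place that is regular on `B` is the place of its centre on `B`, the prime ideal of the elements
that vanish at it, because the valuation ring at the centre is contained in the one of the place. -/
theorem exists_eq_ofHeightOneSpectrum (P : Place k F) (h : ∀ b : B, P.val (algebraMap B F b) ≤ 1) :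
    ∃ p : HeightOneSpectrum B, P = ofHeightOneSpectrum k F p := by
  let φ : B →+* P.ring := (algebraMap B F).codRestrict P.ring h
  have hmem (b : B) : b ∈ (IsLocalRing.maximalIdeal P.ring).comap φ ↔
      P.val (algebraMap B F b) < 1 := by
    rw [Ideal.mem_comap]
    exact Valuation.mem_maximalIdeal_iff (v := P.val)
  let p : HeightOneSpectrum B :=
    { asIdeal := (IsLocalRing.maximalIdeal P.ring).comap φ
      isPrime := inferInstance
      ne_bot := by
        intro h0
        have hone (b : B) (hb : b ≠ 0) : P.val (algebraMap B F b) = 1 := by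
          by_contra hne
          exact hb ((Submodule.mem_bot B).mp (h0 ▸ (hmem b).mpr (lt_of_le_of_ne (h b) hne)))
        obtain ⟨f, hf⟩ := P.surjective (exp (-1))
        obtain ⟨a, b, hb, rfl⟩ := IsFractionRing.div_surjective (A := B) f
        have hb0 := nonZeroDivisors.ne_zero hb
        have ha0 : a ≠ 0 := by
          rintro rfl
          rw [map_zero, zero_div, map_zero] at hf
          exact exp_ne_zero hf.symm
        rw [map_div₀, hone a ha0, hone b hb0, div_one, ← exp_zero, exp_inj] at hf
        omega }
  refine ⟨p, (eq_of_le_one_imp_le_one fun f hf => ?_).symm⟩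
  obtain ⟨a, s, has⟩ := p.exists_primeCompl_mul_eq_of_integer f hf
  have hs : P.val (algebraMap B F s) = 1 := by
    by_contra hne
    exact s.2 ((hmem s).mpr (lt_of_le_of_ne (h s) hne))
  have := congrArg P.val has
  rw [map_mul, hs, mul_one] at this
  rw [this]
  exact h a

/-- The residue field of the place attached to `p` is `B ⧸ p`. -/
theorem degree_ofHeightOneSpectrum (p : HeightOneSpectrum B) :
    (ofHeightOneSpectrum k F p).degree = finrank k (B ⧸ p.asIdeal) := by
  set P := ofHeightOneSpectrum k F p with hP
  have hint (b : B) : P.val (algebraMap B F b) ≤ 1 := p.valuation_le_one b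
  let φ : B →+* P.ring := (algebraMap B F).codRestrict P.ring hint
  let ψ : B →ₐ[k] IsLocalRing.ResidueField P.ring :=
    { toRingHom := (IsLocalRing.residue P.ring).comp φ
      commutes' := fun a => by
        have : φ (algebraMap k B a) = algebraMap k P.ring a :=
          Subtype.ext (IsScalarTower.algebraMap_apply k B F a).symm
        change IsLocalRing.residue P.ring (φ (algebraMap k B a)) = _
        rw [this]
        rfl }
  have hψ : Function.Surjective ψ := by
    intro y
    obtain ⟨f, rfl⟩ := IsLocalRing.residue_surjective y
    obtain ⟨b, hb⟩ := p.exists_valuation_sub_lt_of_integer (K := F) f.2 1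
    refine ⟨b, ?_⟩
    change IsLocalRing.residue P.ring (φ b) = _
    rw [← sub_eq_zero, ← map_sub, IsLocalRing.residue_eq_zero_iff]
    exact (Valuation.mem_maximalIdeal_iff (v := P.val)).mpr hb
  have hker : RingHom.ker ψ = p.asIdeal := by
    ext b
    rw [RingHom.mem_ker]
    change IsLocalRing.residue P.ring (φ b) = 0 ↔ _
    rw [IsLocalRing.residue_eq_zero_iff, ← p.valuation_lt_one_iff_mem (K := F)]
    exact Valuation.mem_maximalIdeal_iff (v := P.val)
  exact ((Ideal.quotientEquivAlgOfEq k hker.symm).trans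
    (Ideal.quotientKerAlgEquivOfSurjective hψ)).toLinearEquiv.finrank_eq.symm

end HeightOneSpectrum

end Place

/-! ### The zeros of a separating element -/

/-- The fundamental identity `∑ e f = n` over the prime `(x)` of `R`, read in terms of places: the
ramification index at a prime over `(x)` is the order of `x` there, and since `R ⧸ (x) = k`, the
inertia degree is the degree of the place. -/
theorem exists_finset_zeros_of_finite {R B : Type*} [CommRing R] [IsDomain R] [CommRing B]
    [IsDedekindDomain B] [Algebra k R] [Algebra R B] [Algebra k B] [IsScalarTower k R B]
    [Module.Finite R B] [Module.Free R B] [Algebra B F] [IsFractionRing B F] [IsScalarTower k B F]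
    {x : R} (hx : Function.Bijective (algebraMap k (R ⧸ Ideal.span {x}))) {z : F}
    (hz0 : z ≠ 0) (hz : algebraMap B F (algebraMap R B x) = z)
    (hreg : ∀ P : Place k F, 0 < P.ord z → ∀ b : B, P.val (algebraMap B F b) ≤ 1) :
    ∃ S : Finset (Place k F), (∀ P, P ∈ S ↔ 0 < P.ord z) ∧
      ∑ P ∈ S, P.ord z * P.degree = finrank R B := by
  classical
  set p : Ideal R := Ideal.span {x} with hp
  have hfield : IsField (R ⧸ p) :=
    (RingEquiv.ofBijective (algebraMap k (R ⧸ p)) hx).symm.toMulEquiv.isField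
      (Field.toIsField k)
  have hpmax : p.IsMaximal := Ideal.Quotient.maximal_of_isField p hfield
  have hxB : algebraMap R B x ≠ 0 := by
    intro h
    rw [h, map_zero] at hz
    exact hz0 hz.symm
  have hmap : p.map (algebraMap R B) = Ideal.span {algebraMap R B x} := by
    rw [hp, Ideal.map_span, Set.image_singleton]
  have : Fintype (p.primesOver B) := (Algebra.QuasiFinite.finite_primesOver p).fintype
  have hmem (q : p.primesOver B) : algebraMap R B x ∈ q.1 := by
    have : x ∈ q.1.under R := by
      rw [← q.2.2.over]
      exact Ideal.mem_span_singleton_self x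
    exact this
  let c (q : p.primesOver B) : HeightOneSpectrum B :=
    ⟨q.1, q.2.1, fun h => hxB (by simpa [h] using hmem q)⟩
  have hc : Function.Injective fun q => Place.ofHeightOneSpectrum k F (c q) := by
    intro q q' h
    exact Subtype.ext
      (congrArg HeightOneSpectrum.asIdeal (Place.ofHeightOneSpectrum_injective h))
  refine ⟨Finset.univ.map ⟨_, hc⟩, fun P => ?_, ?_⟩
  · rw [Finset.mem_map]
    constructor
    · rintro ⟨q, -, rfl⟩
      rw [Place.ord_pos_iff _ hz0, ← hz]
      exact ((c q).valuation_lt_one_iff_mem _).mpr (hmem q)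
    · intro hP
      obtain ⟨𝔮, rfl⟩ := Place.exists_eq_ofHeightOneSpectrum P (hreg P hP)
      rw [Place.ord_pos_iff _ hz0, ← hz] at hP
      have hxq : algebraMap R B x ∈ 𝔮.asIdeal := (𝔮.valuation_lt_one_iff_mem _).mp hP
      have hle : p ≤ 𝔮.asIdeal.under R := by
        rw [hp, Ideal.span_singleton_le_iff_mem]
        exact hxq
      have hprime := 𝔮.isPrime
      have hover : p = 𝔮.asIdeal.under R :=
        hpmax.eq_of_le (Ideal.IsPrime.under R 𝔮.asIdeal).ne_top hle
      exact ⟨⟨𝔮.asIdeal, 𝔮.isPrime, ⟨hover⟩⟩, Finset.mem_univ _, rfl⟩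
  · rw [Finset.sum_map, ← Ideal.sum_ramification_inertia_eq_finrank p B, Nat.cast_sum]
    refine Finset.sum_congr rfl fun q _ => ?_
    have := q.2.1
    have := q.2.2
    have : q.1.IsMaximal := (c q).isMaximal
    have he : q.1.ramificationIdx R = multiplicity q.1 (p.map (algebraMap R B)) :=
      Ideal.IsDedekindDomain.ramificationIdx_eq_multiplicity p q.1 (by
        rw [hmap, Ne, Ideal.span_singleton_eq_bot]
        exact hxB)
    have hf : q.1.inertiaDeg R = finrank k (B ⧸ q.1) := by
      rw [Ideal.inertiaDeg_eq_of_isMaximal p q.1]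
      refine (Algebra.finrank_eq_of_equiv_equiv (RingEquiv.ofBijective (algebraMap k (R ⧸ p)) hx)
        (RingEquiv.refl _) ?_).symm
      ext a
      change Ideal.Quotient.mk q.1 (algebraMap R B (algebraMap k R a)) =
        Ideal.Quotient.mk q.1 (algebraMap k B a)
      rw [← IsScalarTower.algebraMap_apply]
    rw [he, hf]
    change (Place.ofHeightOneSpectrum k F (c q)).ord z *
      ((Place.ofHeightOneSpectrum k F (c q)).degree : ℤ) = _
    rw [Place.degree_ofHeightOneSpectrum, Nat.cast_mul]
    congr 1
    rw [Place.ord, Place.ofHeightOneSpectrum_val, ← hz, HeightOneSpectrum.valuation_of_algebraMap,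
      HeightOneSpectrum.intValuation_eq_exp_neg_multiplicity _ hxB, log_exp, neg_neg, hmap]

open IntermediateField.algebraAdjoinAdjoin in
/-- A separating element `z` has finitely many zeros, and its zero divisor has degree
`[F : k(z)]`. Separability enters because it makes the integral closure of `k[z]` in `F` a finite
module over `k[z]`. -/
theorem exists_finset_zeros {z : F} (hz : Transcendental k z)
    [Algebra.IsSeparable (IntermediateField.adjoin k {z}) F]
    [FiniteDimensional (IntermediateField.adjoin k {z}) F] :
    ∃ S : Finset (Place k F), (∀ P, P ∈ S ↔ 0 < P.ord z) ∧
      ∑ P ∈ S, P.ord z * P.degree = finrank (IntermediateField.adjoin k {z}) F := by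
  let R := Algebra.adjoin k {z}
  let K := IntermediateField.adjoin k {z}
  let e : Polynomial k ≃ₐ[k] R := Polynomial.algEquivOfTranscendental k z hz
  have hpir : IsPrincipalIdealRing R := .of_surjective e e.surjective
  let B := integralClosure R F
  have : IsDedekindDomain B := integralClosure.isDedekindDomain R K F
  have : IsFractionRing B F := integralClosure.isFractionRing_of_finite_extension K F
  have : Module.Finite R B := IsIntegralClosure.finite R K F B
  have : Module.Free R B := IsIntegralClosure.module_free R K F B
  have hrank : finrank R B = finrank K F := IsIntegralClosure.rank R K F B
  have hz0 : z ≠ 0 := by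
    rintro rfl
    exact hz isAlgebraic_zero
  let x : R := ⟨z, Algebra.self_mem_adjoin_singleton k z⟩
  have hex : e Polynomial.X = x := Polynomial.algEquivOfTranscendental_apply_X k z hz
  rw [← hrank]
  refine exists_finset_zeros_of_finite (R := R) (B := B) (x := x) ⟨?_, fun y => ?_⟩ hz0 rfl ?_
  · have : Nontrivial (R ⧸ Ideal.span {x}) := by
      rw [Ideal.Quotient.nontrivial_iff, Ne, Ideal.span_singleton_eq_top, ← hex,
        MulEquiv.isUnit_map]
      exact Polynomial.not_isUnit_X
    exact (algebraMap k _).injective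
  · obtain ⟨r, rfl⟩ := Ideal.Quotient.mk_surjective y
    obtain ⟨g, rfl⟩ := e.surjective r
    refine ⟨g.coeff 0, ?_⟩
    change Ideal.Quotient.mk _ (algebraMap k R (g.coeff 0)) = _
    rw [eq_comm, Ideal.Quotient.eq, Ideal.mem_span_singleton, ← e.commutes, ← map_sub, ← hex]
    exact map_dvd e (Polynomial.X_dvd_sub_C)
  · intro P hP b
    have hzP : z ∈ P.ring := ((P.ord_pos_iff hz0).mp hP).le
    let A : Subalgebra k F := { P.ring.toSubring with algebraMap_mem' := P.algebraMap_mem }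
    have hR (r : R) : (r : F) ∈ P.ring := by
      have : R ≤ A := Algebra.adjoin_le (Set.singleton_subset_iff.mpr hzP)
      exact this r.2
    obtain ⟨g, hg, hgb⟩ : IsIntegral R (b : F) := b.2
    have hint : IsIntegral P.ring (b : F) := by
      refine ⟨g.map ((algebraMap R F).codRestrict P.ring hR), hg.map _, ?_⟩
      rw [Polynomial.eval₂_map]
      exact hgb
    obtain ⟨y, hy⟩ := IsIntegrallyClosed.isIntegral_iff.mp hint
    have : (b : F) ∈ P.ring := hy ▸ y.2
    exact this

/-! ### Separating elements and the degree of principal divisors -/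

/-- An element `z` is separating if and only if `dz` spans the differentials of `F / k`; dually, a
`k`-derivation of `F` that kills `z` vanishes. -/
theorem isSeparable_adjoin_simple_iff [Algebra.EssFiniteType k F] (z : F) :
    Algebra.IsSeparable k⟮z⟯ F ↔ ∀ D : Derivation k F F, D z = 0 → D = 0 := by
  have : Algebra.EssFiniteType k⟮z⟯ F := Algebra.EssFiniteType.of_comp k k⟮z⟯ F
  rw [← Algebra.FormallyUnramified.iff_isSeparable]
  constructor
  · intro _ D hD
    have hker (a : F) (ha : a ∈ k⟮z⟯) : D a = 0 := by
      induction ha using IntermediateField.adjoin_induction with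
      | mem x hx => rwa [Set.mem_singleton_iff.mp hx]
      | algebraMap x => exact D.map_algebraMap x
      | add x y _ _ hx hy => rw [map_add, hx, hy, add_zero]
      | inv x _ hx => rw [D.leibniz_inv, hx, smul_zero]
      | mul x y _ _ hx hy => rw [D.leibniz, hx, hy, smul_zero, smul_zero, add_zero]
    let D' : Derivation k⟮z⟯ F F := Derivation.mk'
      { toFun := D
        map_add' := map_add D
        map_smul' := fun a x => by
          rw [Algebra.smul_def, D.leibniz, RingHom.id_apply]
          have : D (algebraMap k⟮z⟯ F a) = 0 := hker _ a.2
          rw [this, smul_zero, add_zero, algebraMap_smul] }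
      (fun a b => D.leibniz a b)
    have hD' : D' = 0 := by
      rw [← D'.liftKaehlerDifferential_comp,
        Subsingleton.elim D'.liftKaehlerDifferential 0]
      ext
      simp
    ext x
    exact DFunLike.congr_fun hD' x
  · intro h
    refine .of_forall_derivation_eq_zero fun D => ?_
    have hz : D z = 0 := D.map_algebraMap (IntermediateField.AdjoinSimple.gen k z)
    have hD := h (D.restrictScalars k) hz
    ext x
    exact DFunLike.congr_fun hD x

/-- The space of `k`-derivations of `F` has dimension at most one when a separating element `y`
exists, so if `f` and `f y` both fail to be separating, then some nonzero derivation kills `f`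
and `f y`, hence also `y`. -/
theorem isSeparable_or_isSeparable_mul [Algebra.EssFiniteType k F] {y f : F} (hf : f ≠ 0)
    (hy : Algebra.IsSeparable k⟮y⟯ F) :
    Algebra.IsSeparable k⟮f⟯ F ∨ Algebra.IsSeparable k⟮f * y⟯ F := by
  rw [isSeparable_adjoin_simple_iff] at *
  rw [isSeparable_adjoin_simple_iff]
  by_contra! h
  obtain ⟨⟨D, hDf, hD⟩, E, hEf, hE⟩ := h
  have hDy : D y ≠ 0 := fun h => hD (hy D h)
  have hEy : E y ≠ 0 := fun h => hE (hy E h)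
  have h0 : E y • D - D y • E = 0 := hy _ (by simp [mul_comm])
  have h1 := DFunLike.congr_fun h0 f
  simp [hDf, hDy] at h1
  simp [h1, hf, hEy] at hEf

open IntermediateField.algebraAdjoinAdjoin in
/-- A finitely generated extension of transcendence degree at most one of a perfect field has a
separating element. -/
theorem exists_isSeparable_adjoin_simple [PerfectField k] [Algebra.EssFiniteType k F] {x : F}
    (hx : Algebra.IsAlgebraic k⟮x⟯ F) : ∃ y : F, Algebra.IsSeparable k⟮y⟯ F := by
  obtain ⟨s, hs, hsep⟩ := exists_isTranscendenceBasis_and_isSeparable_of_perfectField k F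
  have : Algebra.IsAlgebraic (Algebra.adjoin k {x}) F :=
    Algebra.IsAlgebraic.trans (Algebra.adjoin k {x}) k⟮x⟯ F
  obtain ⟨t, htx, ht⟩ := isAlgebraic_iff_exists_isTranscendenceBasis_subset.mp this
  have hle := Cardinal.mk_le_mk_of_subset htx
  rw [← hs.cardinalMk_eq ht, Cardinal.mk_singleton, Cardinal.mk_coe_finset] at hle
  obtain ⟨y, hy⟩ := Finset.card_le_one_iff_subset_singleton.mp (Nat.cast_le_one.mp hle)
  have hsy : IntermediateField.adjoin k (s : Set F) ≤ k⟮y⟯ :=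
    IntermediateField.adjoin.mono k _ _ (by exact_mod_cast hy)
  refine ⟨y, ?_⟩
  let := (IntermediateField.inclusion hsy).toRingHom.toAlgebra
  have : IsScalarTower (IntermediateField.adjoin k (s : Set F)) k⟮y⟯ F :=
    .of_algebraMap_eq fun _ => rfl
  exact Algebra.isSeparable_tower_top_of_isSeparable (IntermediateField.adjoin k (s : Set F)) k⟮y⟯ F

theorem Divisor.deg_single (P : Place k F) (a : ℤ) :
    Divisor.deg (Finsupp.single P a) = a * P.degree := by
  change Finsupp.linearCombination ℤ _ _ = _
  rw [Finsupp.linearCombination_single, smul_eq_mul]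

theorem finiteDimensional_of_isSeparable [Algebra.EssFiniteType k F] (z : F)
    [Algebra.IsSeparable k⟮z⟯ F] : FiniteDimensional k⟮z⟯ F :=
  have : Algebra.EssFiniteType k⟮z⟯ F := Algebra.EssFiniteType.of_comp k k⟮z⟯ F
  Algebra.finite_of_essFiniteType_of_isAlgebraic

/-- The zero divisors of a separating element `z` and of `1 / z` both have degree `[F : k(z)]`. -/
theorem exists_divisor_of_isSeparable [Algebra.EssFiniteType k F] {z : F}
    (hz : Transcendental k z) [hsep : Algebra.IsSeparable k⟮z⟯ F] :
    ∃ D : Divisor k F, (∀ P, D P = P.ord z) ∧ Divisor.deg D = 0 := by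
  classical
  have hinv : k⟮z⁻¹⟯ = k⟮z⟯ := by
    apply le_antisymm <;> rw [IntermediateField.adjoin_simple_le_iff]
    · exact inv_mem (IntermediateField.mem_adjoin_simple_self k z)
    · have := inv_mem (IntermediateField.mem_adjoin_simple_self k z⁻¹)
      rwa [inv_inv] at this
  have hsep' : Algebra.IsSeparable k⟮z⁻¹⟯ F := hinv ▸ hsep
  have := finiteDimensional_of_isSeparable (k := k) z
  have := finiteDimensional_of_isSeparable (k := k) z⁻¹
  have hz' : Transcendental k z⁻¹ := fun h => hz (inv_inv z ▸ h.inv)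
  obtain ⟨S, hS, hSdeg⟩ := exists_finset_zeros hz
  obtain ⟨T, hT, hTdeg⟩ := exists_finset_zeros hz'
  refine ⟨∑ P ∈ S, Finsupp.single P (P.ord z) - ∑ P ∈ T, Finsupp.single P (P.ord z⁻¹),
    fun P => ?_, ?_⟩
  · simp only [Finsupp.sub_apply, Finsupp.finsetSum_apply, Finsupp.single_apply,
      Finset.sum_ite_eq', hS, hT, Place.ord_inv]
    split_ifs <;> omega
  · rw [map_sub, map_sum, map_sum]
    simp only [Divisor.deg_single]
    rw [hSdeg, hTdeg, hinv, sub_self]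

/-- A nonzero function has a principal divisor, of degree zero. A function `f` that is neither
constant nor separating is the quotient of the separating elements `f y` and `y`. -/
theorem exists_divisor [PerfectField k] [Algebra.EssFiniteType k F] {x : F}
    (hx : Transcendental k x) (halg : Algebra.IsAlgebraic k⟮x⟯ F) {f : F} (hf : f ≠ 0) :
    ∃ D : Divisor k F, (∀ P, D P = P.ord f) ∧ Divisor.deg D = 0 := by
  have htr (z : F) (hz : Algebra.IsSeparable k⟮z⟯ F) : Transcendental k z := fun h => by
    have := IntermediateField.isAlgebraic_adjoin_simple h.isIntegral
    have := Algebra.IsAlgebraic.trans k k⟮z⟯ F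
    exact hx (Algebra.IsAlgebraic.isAlgebraic x)
  obtain ⟨y, hy⟩ := exists_isSeparable_adjoin_simple halg
  rcases isSeparable_or_isSeparable_mul hf hy with h | h
  · exact exists_divisor_of_isSeparable (htr f h)
  · have hy0 : y ≠ 0 := fun h0 => htr y hy (h0 ▸ isAlgebraic_zero)
    obtain ⟨D, hD, hDdeg⟩ := exists_divisor_of_isSeparable (htr _ h)
    obtain ⟨E, hE, hEdeg⟩ := exists_divisor_of_isSeparable (htr _ hy)
    refine ⟨D - E, fun P => ?_, by rw [map_sub, hDdeg, hEdeg, sub_self]⟩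
    rw [Finsupp.sub_apply, hD, hE, Place.ord_mul P hf hy0, add_sub_cancel_right]

/-- Principal divisors of a function field over a perfect field exist and have degree zero. -/
theorem exists_divisor_of_functionField [PerfectField k] [Algebra (RatFunc k) F]
    [IsScalarTower k (RatFunc k) F] [FunctionField k F] {f : F} (hf : f ≠ 0) :
    ∃ D : Divisor k F, (∀ P, D P = P.ord f) ∧ Divisor.deg D = 0 := by
  have : Algebra.EssFiniteType k F := by
    have : Algebra.EssFiniteType k (RatFunc k) :=
      have := Algebra.EssFiniteType.of_isLocalization (RatFunc k)
        (nonZeroDivisors (Polynomial k))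
      Algebra.EssFiniteType.comp k (Polynomial k) (RatFunc k)
    exact Algebra.EssFiniteType.comp k (RatFunc k) F
  let x := algebraMap (RatFunc k) F RatFunc.X
  have hx : Transcendental k x :=
    (transcendental_algebraMap_iff (algebraMap (RatFunc k) F).injective).mpr RatFunc.transcendental_X
  exact AGCode.exists_divisor hx FunctionField.Algebra.IsAlgebraic.adjoin_algebraMap_X hf

/-! ### Weak approximation -/

namespace Place

/-- The absolute value `|f| = 2 ^ (-v_P(f))`. -/
noncomputable def absoluteValue (P : Place k F) : AbsoluteValue F ℝ where
  toFun f := WithZeroMulInt.toNNReal two_ne_zero (P.val f)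
  map_mul' f g := by simp
  nonneg' f := NNReal.coe_nonneg _
  eq_zero' f := by simp
  add_le' f g := by
    have hmono := (WithZeroMulInt.toNNReal_strictMono (e := 2) one_lt_two).monotone
    rw [← NNReal.coe_add, NNReal.coe_le_coe]
    calc _ ≤ WithZeroMulInt.toNNReal two_ne_zero (max (P.val f) (P.val g)) :=
          hmono (P.val.map_add f g)
      _ = max _ _ := hmono.map_max
      _ ≤ _ := max_le (le_add_of_nonneg_right zero_le) (le_add_of_nonneg_left zero_le)

theorem absoluteValue_lt_iff (P : Place k F) {f g : F} :
    P.absoluteValue f < P.absoluteValue g ↔ P.val f < P.val g :=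
  (NNReal.coe_lt_coe.trans
    (WithZeroMulInt.toNNReal_strictMono (e := 2) one_lt_two).lt_iff_lt)

theorem absoluteValue_le_iff (P : Place k F) {f g : F} :
    P.absoluteValue f ≤ P.absoluteValue g ↔ P.val f ≤ P.val g := by
  rw [← not_lt, ← not_lt, absoluteValue_lt_iff]

/-- Weak approximation: functions with prescribed orders at finitely many places. -/
theorem exists_forall_ord_eq {ι : Type*} [Finite ι] {P : ι → Place k F}
    (hP : Function.Injective P) (a : ι → ℤ) : ∃ f : F, ∀ i, (P i).val f = exp (-a i) := by
  have := Fintype.ofFinite ι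
  choose g hg using fun i => (P i).surjective (exp (-a i))
  have hg0 (i : ι) : g i ≠ 0 := by
    intro h
    have := hg i
    rw [h, map_zero] at this
    exact exp_ne_zero this.symm
  have hdense := AbsoluteValue.denseRange_algebraMap_pi (v := fun i => (P i).absoluteValue)
    (fun i => by
      obtain ⟨π, hπ⟩ := (P i).surjective (exp (-1))
      refine ⟨π, ?_, fun h => ?_⟩
      · rintro rfl
        rw [map_zero] at hπ
        exact exp_ne_zero hπ.symm
      · rw [← map_one (P i).absoluteValue] at h
        have := (P i).absoluteValue_le_iff.mp h.ge
        rw [hπ, map_one, ← exp_zero, exp_le_exp] at this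
        omega)
    (fun i j hij h => hij (hP (eq_of_le_one_imp_le_one fun f hf => by
      rw [← map_one (P j).val, ← absoluteValue_le_iff]
      rw [← map_one (P i).val, ← absoluteValue_le_iff] at hf
      exact (h _ _).mp hf)))
  -- An `f` with `|f - g i| < |g i|` at `P i` has the order of `g i` there.
  obtain ⟨f, hf⟩ := hdense.exists_mem_open
    (isOpen_set_pi Set.finite_univ (s := fun i : ι =>
      Metric.ball (WithAbs.toAbs (P i).absoluteValue (g i)) ((P i).absoluteValue (g i)))
      fun _ _ => Metric.isOpen_ball)
    ⟨fun i => WithAbs.toAbs _ (g i), fun i _ =>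
      Metric.mem_ball_self ((P i).absoluteValue.pos (hg0 i))⟩
  refine ⟨f, fun i => ?_⟩
  have hi := hf i (Set.mem_univ i)
  rw [Metric.mem_ball, dist_eq_norm] at hi
  have hi' : (P i).absoluteValue (f - g i) < (P i).absoluteValue (g i) := hi
  rw [← hg i]
  exact (P i).val.map_eq_of_sub_lt ((P i).absoluteValue_lt_iff.mp hi')

end Place

/-! ### Local expansions and the numbers `j_l` -/

/-- A function vanishes to order at least `N` at `P` if and only if its first `N` coefficients are
zero. -/
theorem Place.val_le_exp_neg_iff (P : Place k F) (hP : P.IsRational) {t : F}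
    (ht : P.IsLocalParameter t) (f : P.ring) (N : ℕ) :
    P.val (f : F) ≤ exp (-(N : ℤ)) ↔ ∀ l < N, P.expansionCoeff hP ht l f = 0 := by
  constructor
  · intro hf l
    induction l using Nat.strong_induction_on with
    | _ l ih =>
      intro hl
      by_contra hne
      have h1 := P.val_sub_sum_expansionCoeff_le hP ht f (l + 1)
      have hs : ∑ l ∈ Finset.range l, algebraMap k F (P.expansionCoeff hP ht l f) * t ^ l = 0 :=
        Finset.sum_eq_zero fun j hj => by
          have hj := Finset.mem_range.mp hj
          rw [ih j hj (hj.trans hl), map_zero, zero_mul]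
      rw [Finset.sum_range_succ, hs, zero_add] at h1
      have hf' : P.val (f : F) ≤ exp (-((l + 1 : ℕ) : ℤ)) :=
        hf.trans (exp_le_exp.mpr (by omega))
      have h2 := (P.val.map_sub _ _).trans (max_le hf' h1)
      rw [sub_sub_cancel, map_mul, map_pow, ht.val_eq, P.isTrivialOn.eq_one _ hne, one_mul,
        ← exp_nsmul, exp_le_exp] at h2
      simp at h2
  · intro h
    have h1 := P.val_sub_sum_expansionCoeff_le hP ht f N
    rwa [Finset.sum_eq_zero fun l hl => by rw [h l (Finset.mem_range.mp hl), map_zero, zero_mul],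
      sub_zero] at h1

section Conditions

variable {n : ℕ} (P : Fin n ≃ RationalPlace k F) (m : ℕ)

theorem deg_restrictDivisor (D : Place k F → ℤ) :
    Divisor.deg (restrictDivisor P m D) = ∑ i, min ((m : ℤ) + 1) (D (P i)) := by
  rw [restrictDivisor, map_sum]
  refine Finset.sum_congr rfl fun i _ => ?_
  have h : (P i : Place k F).degree = 1 := (P i).2
  rw [Divisor.deg_single, h, Nat.cast_one, mul_one]

variable {P m} {D E : Place k F → ℤ}

theorem jCount_congr (h : ∀ i, D (P i) = E (P i)) (l : ℕ) : jCount P m D l = jCount P m E l := by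
  simp only [jCount, h]

theorem CountCondition.congr (h : ∀ i, D (P i) = E (P i)) {X : ℕ → ℕ}
    (hD : CountCondition P m X D) : CountCondition P m X E := fun l hl =>
  jCount_congr h l ▸ hD l hl

theorem WeightCondition.congr (h : ∀ i, D (P i) = E (P i)) {X : ℕ → ℕ}
    (hD : WeightCondition P m X D) : WeightCondition P m X E := by
  simpa only [WeightCondition, jWeight, jCount_congr h] using hD

theorem jCount_eq_zero (h : ∀ i, (m : ℤ) ≤ D (P i)) {l : ℕ} (hl : 1 ≤ l) :
    jCount P m D l = 0 := by
  have : IsEmpty {i : Fin n // D (P i) = (m : ℤ) - l} := ⟨fun i => by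
    have := h i
    have := i.2
    omega⟩
  exact Nat.card_of_isEmpty

theorem countCondition_of_le (h : ∀ i, (m : ℤ) ≤ D (P i)) (X : ℕ → ℕ) :
    CountCondition P m X D := fun l hl => by
  rw [jCount_eq_zero h (Finset.mem_Icc.mp hl).1]
  exact Nat.zero_le _

theorem weightCondition_of_le (h : ∀ i, (m : ℤ) ≤ D (P i)) (X : ℕ → ℕ) :
    WeightCondition P m X D := by
  rw [WeightCondition, jWeight, Finset.sum_eq_zero fun l hl => by
    rw [jCount_eq_zero h (Finset.mem_Icc.mp hl).1, mul_zero]]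
  exact Nat.zero_le _

end Conditions

/-! ### Existence of the divisor `G` -/

/-- Fewer divisors in `V_m(r, s; X)` than divisor classes of degree zero leave a class of degree `r`
that `V_m(r, s; X)` misses, and by weak approximation that class has a member `G` supported away
from the rational places. For `f ∈ L(G)`, the divisor `G + (f)` is a positive member of the class
that has the coefficients of `(f)_0` at the rational places. -/
theorem exists_isDistinguished [PerfectField k] [Algebra (RatFunc k) F]
    [IsScalarTower k (RatFunc k) F] [FunctionField k F]
    {n : ℕ} (hn : 1 ≤ n) (P : Fin n ≃ RationalPlace k F) (m r s : ℕ) (X : ℕ → ℕ)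
    (hV : (divisorSet P m r s X).encard < Divisor.classNumber k F) :
    ∃ G : Divisor k F, IsDistinguished P m r s X G := by
  let A : Divisor k F := Finsupp.single (P ⟨0, hn⟩ : Place k F) (r : ℤ)
  have hA : Divisor.deg A = r := by
    have h : (P ⟨0, hn⟩ : Place k F).degree = 1 := (P ⟨0, hn⟩).2
    rw [Divisor.deg_single, h, Nat.cast_one, mul_one]
  -- The class of `D`, moved to degree zero by subtracting `A`.
  let c (D : divisorSet P m r s X) : Divisor.degZero k F ⧸
      (Divisor.principal k F).addSubgroupOf (Divisor.degZero k F) :=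
    QuotientAddGroup.mk ⟨D.1 - A, by
      rw [Divisor.degZero, AddMonoidHom.mem_ker, map_sub, D.2.2.1, hA, sub_self]⟩
  have hc : ¬ Function.Surjective c := fun h =>
    hV.not_ge (ENat.card_le_card_of_injective (Function.injective_surjInv h))
  obtain ⟨y, hy⟩ := not_forall.mp hc
  obtain ⟨⟨E, hE⟩, rfl⟩ := QuotientAddGroup.mk_surjective y
  obtain ⟨f, hf⟩ := Place.exists_forall_ord_eq (P := fun i => (P i : Place k F))
    (Subtype.val_injective.comp P.injective) fun i => -(A + E) (P i)
  have hf0 : f ≠ 0 := by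
    rintro rfl
    have := hf ⟨0, hn⟩
    rw [map_zero] at this
    exact exp_ne_zero this.symm
  have hfP (i : Fin n) : (P i : Place k F).ord f = -(A + E) (P i) := by
    rw [Place.ord, hf, log_exp, neg_neg]
  obtain ⟨B, hB, hBdeg⟩ := exists_divisor_of_functionField (k := k) hf0
  have hG0 (i : Fin n) : (A + E + B) (P i) = 0 := by
    rw [Finsupp.add_apply, hB, hfP, add_neg_cancel]
  have hGdeg : Divisor.deg (A + E + B) = r := by
    rw [map_add, map_add, hA, hBdeg, AddMonoidHom.mem_ker.mp hE, add_zero, add_zero]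
  refine ⟨A + E + B, hGdeg, hG0, fun g hg hg0 hcount hweight => ?_⟩
  by_contra! hlt
  obtain ⟨C, hC, hCdeg⟩ := exists_divisor_of_functionField (k := k) hg0
  have hpos (Q : Place k F) : 0 ≤ (A + E + B + C) Q := by
    have := ((Divisor.mem_riemannRoch_iff _ _).mp hg).resolve_left hg0 Q
    rw [Finsupp.add_apply, hC]
    omega
  have hval (i : Fin n) : zeroDivisor g (P i : Place k F) = (A + E + B + C) (P i) := by
    have := hpos (P i)
    rw [Finsupp.add_apply, hG0, hC, zero_add] at *
    exact max_eq_left this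
  have hmem : A + E + B + C ∈ divisorSet P m r s X := by
    refine ⟨fun Q => hpos Q, by rw [map_add, hGdeg, hCdeg, add_zero], ?_,
      hcount.congr hval, hweight.congr hval⟩
    rw [deg_restrictDivisor] at hlt ⊢
    simp only [hval] at hlt
    omega
  -- `A + E + (f) + (g)` lies in the class of `A + E`, which was chosen to avoid the set.
  refine hy ⟨⟨_, hmem⟩, ?_⟩
  rw [QuotientAddGroup.eq, AddSubgroup.mem_addSubgroupOf]
  refine ⟨(f * g)⁻¹, inv_ne_zero (mul_ne_zero hf0 hg0), fun Q => ?_⟩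
  rw [Place.ord_inv, Place.ord_mul Q hf0 hg0, ← hB, ← hC]
  change (-(A + E + B + C - A) + E) Q = _
  simp only [Finsupp.add_apply, Finsupp.neg_apply, Finsupp.sub_apply]
  ring

/-! ### The code -/

section Code

variable {n : ℕ} {P : Fin n ≃ RationalPlace k F} {m : ℕ} {t : Fin n → F}
  (ht : ∀ i, (P i : Place k F).IsLocalParameter (t i))
  {G : Divisor k F} (hG : ∀ i, G (P i) = 0)

theorem localCoeff_eq_zero_iff (i : Fin n) (N : ℕ) (f : G.riemannRoch) :
    (∀ l < N, localCoeff P ht G hG i l f = 0) ↔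
      (P i : Place k F).val (f : F) ≤ exp (-(N : ℤ)) :=
  ((P i : Place k F).val_le_exp_neg_iff (P i).2 (ht i) (G.toRing (P i) (hG i) f) N).symm

theorem mem_ker_Phi_iff_localCoeff (f : G.riemannRoch) :
    f ∈ LinearMap.ker (Phi P m ht G hG) ↔ ∀ i, ∀ l < m, localCoeff P ht G hG i l f = 0 := by
  rw [LinearMap.mem_ker, funext_iff]
  refine forall_congr' fun i => ?_
  rw [funext_iff]
  constructor
  · intro h l hl
    have := h (Fin.rev ⟨l, hl⟩)
    change localCoeff P ht G hG i (Fin.rev (Fin.rev ⟨l, hl⟩) : Fin m) f = 0 at this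
    rwa [Fin.rev_rev] at this
  · intro h j
    exact h _ (Fin.rev j).2

theorem mem_ker_Phi_iff (f : G.riemannRoch) :
    f ∈ LinearMap.ker (Phi P m ht G hG) ↔
      ∀ i, (P i : Place k F).val (f : F) ≤ exp (-(m : ℤ)) := by
  simp only [mem_ker_Phi_iff_localCoeff, localCoeff_eq_zero_iff]

theorem map_ker_Phi :
    (LinearMap.ker (Phi P m ht G hG)).map G.riemannRoch.subtype =
      (G - m • ∑ i, Finsupp.single (P i : Place k F) 1).riemannRoch := by
  classical
  set D : Divisor k F := G - m • ∑ i, Finsupp.single (P i : Place k F) 1 with hD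
  have hinj : Function.Injective fun i => (P i : Place k F) :=
    Subtype.val_injective.comp P.injective
  have happ (Q : Place k F) : D Q =
      G Q - m * ∑ i, if (P i : Place k F) = Q then 1 else 0 := by
    simp [hD, Finsupp.single_apply]
  have hP (i : Fin n) : D (P i) = -m := by
    rw [happ, hG]
    simp [hinj.eq_iff]
  have hle (Q : Place k F) : D Q ≤ G Q := by
    rw [happ, sub_le_self_iff]
    positivity
  ext f
  constructor
  · rintro ⟨f, hf, rfl⟩ Q
    by_cases hQ : ∃ i, (P i : Place k F) = Q
    · obtain ⟨i, rfl⟩ := hQ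
      rw [hP]
      exact (mem_ker_Phi_iff ht hG f).mp hf i
    · rw [happ, Finset.sum_eq_zero fun i _ => if_neg fun h => hQ ⟨i, h⟩, mul_zero, sub_zero]
      exact f.2 Q
  · intro hf
    refine ⟨⟨f, fun Q => (hf Q).trans (exp_le_exp.mpr (hle Q))⟩, ?_, rfl⟩
    refine (mem_ker_Phi_iff ht hG _).mpr fun i => ?_
    exact hP i ▸ hf (P i)

/-- A nonzero `f ∈ Ker Φ` vanishes to order at least `m` at every `P_i`, so no `P_i` is counted in
`j_1, …, j_m`, and it vanishes to order at least `m + 1` where `ψ(f)` is zero. Hence the bound on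
`deg Ē` bounds the number of zeros of `ψ(f)`. -/
theorem le_hammingNorm_psi [DecidableEq k] {r s : ℕ} {X : ℕ → ℕ}
    (hdist : IsDistinguished P m r s X G)
    {f : G.riemannRoch} (hf : f ∈ LinearMap.ker (Phi P m ht G hG)) (hf0 : f ≠ 0) :
    ((m + 1) * n + 1 - s : ℤ) ≤ hammingNorm (psi P m ht G hG f) := by
  have hfF : (f : F) ≠ 0 := fun h => hf0 (Subtype.ext h)
  have hm (i : Fin n) : (m : ℤ) ≤ zeroDivisor (f : F) (P i : Place k F) :=
    (((P i : Place k F).le_ord_iff hfF m).mpr ((mem_ker_Phi_iff ht hG f).mp hf i)).trans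
      (le_max_left _ _)
  have hdeg := hdist.deg_restrict_le f f.2 hfF (countCondition_of_le hm X)
    (weightCondition_of_le hm X)
  rw [deg_restrictDivisor] at hdeg
  have hterm (i : Fin n) : (m : ℤ) + 1 - (if psi P m ht G hG f i ≠ 0 then 1 else 0) ≤
      min ((m : ℤ) + 1) (zeroDivisor (f : F) (P i : Place k F)) := by
    split_ifs with h
    · have := hm i
      omega
    · rw [not_not] at h
      rw [sub_zero]
      refine le_min le_rfl (le_max_of_le_left ?_)
      have := ((P i : Place k F).le_ord_iff hfF ((m + 1 : ℕ) : ℤ)).mpr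
        ((localCoeff_eq_zero_iff ht hG i (m + 1) f).mp fun l hl => by
          rcases Nat.lt_succ_iff_lt_or_eq.mp hl with hl | rfl
          · exact (mem_ker_Phi_iff_localCoeff ht hG f).mp hf i l hl
          · exact h)
      exact_mod_cast this
  have hsum := (Finset.sum_le_sum fun i _ => hterm i).trans hdeg
  rw [Finset.sum_sub_distrib, Finset.sum_boole] at hsum
  simp only [Finset.sum_const, Finset.card_univ, Fintype.card_fin, nsmul_eq_mul] at hsum
  rw [hammingNorm]
  linarith

end Code

/-- The minimum distance is attained; for a code with at most one word it has the junk value `0`. -/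
theorem exists_hammingDist_eq_minDist {K : Type*} [DecidableEq K] {n : ℕ} {C : Set (Fin n → K)}
    (hC : C.Nontrivial) : ∃ x ∈ C, ∃ y ∈ C, x ≠ y ∧ hammingDist x y = minDist C := by
  obtain ⟨x, hx, y, hy, hxy⟩ := hC
  have hne : {d | ∃ x ∈ C, ∃ y ∈ C, x ≠ y ∧ hammingDist x y = d}.Nonempty :=
    ⟨_, x, hx, y, hy, hxy, rfl⟩
  have h : minDist C = sInf {d | ∃ x ∈ C, ∃ y ∈ C, x ≠ y ∧ hammingDist x y = d} := by
    -- The two sides differ in the instance of decidable equality only.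
    unfold minDist
    congr!
  exact h ▸ Nat.sInf_mem hne

end AGCode

open AGCode

theorem corollary2p10 {k F : Type*} [Field k] [Finite k] [Field F] [Algebra k F]
    [Algebra (RatFunc k) F] [IsScalarTower k (RatFunc k) F] [FunctionField k F]
    (full_constant_field : ∀ a : F, IsAlgebraic k a → a ∈ Set.range (algebraMap k F))
    (n : ℕ) (hn : 1 ≤ n) (P : Fin n ≃ AGCode.RationalPlace k F)
    (t : Fin n → F) (ht : ∀ i, (P i : AGCode.Place k F).IsLocalParameter (t i))
    (m : ℕ) (hm : 1 ≤ m) (r s : ℕ) (hsr : s ≤ r)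
    (hV : (AGCode.divisorSet P m r s (fun _ => 0)).encard < AGCode.Divisor.classNumber k F) :
    (∃ G : AGCode.Divisor k F, AGCode.IsDistinguished P m r s (fun _ => 0) G) ∧
    ∀ (G : AGCode.Divisor k F) (hG : AGCode.IsDistinguished P m r s (fun _ => 0) G),
      Nat.card k ^ (m * n) < Nat.card G.riemannRoch →
      s ≤ (m + 1) * n →
      (LinearMap.ker (AGCode.Phi P m ht G hG.apply_eq_zero)).map G.riemannRoch.subtype =
          (G - m • ∑ i, Finsupp.single (P i : AGCode.Place k F) 1).riemannRoch ∧
        (Module.finrank k G.riemannRoch : ℤ) - m * n ≤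
          Module.finrank k (AGCode.code P m ht G hG.apply_eq_zero) ∧
        ((m + 1) * n + 1 - s : ℤ) ≤
          AGCode.minDist (AGCode.code P m ht G hG.apply_eq_zero : Set (Fin n → k)) := by
  classical
  refine ⟨exists_isDistinguished hn P m r s _ hV, fun G hG hcard hs => ?_⟩
  have hG0 := hG.apply_eq_zero
  refine ⟨map_ker_Phi ht hG0, ?_⟩
  have hs' : (s : ℤ) ≤ (m + 1) * n := by exact_mod_cast hs
  have : Finite G.riemannRoch := Nat.finite_of_card_ne_zero (Nat.ne_zero_of_lt hcard)
  have : Module.Finite k G.riemannRoch := Module.Finite.of_finite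
  -- `ψ` is injective on `Ker Φ`, because the bound on the weight of `ψ(f)` is at least `1`.
  have hinj : Function.Injective
      ((psi P m ht G hG0).domRestrict (LinearMap.ker (Phi P m ht G hG0))) := by
    rw [injective_iff_map_eq_zero]
    intro f hf
    by_contra hf0
    have h1 := le_hammingNorm_psi ht hG0 hG f.2 (fun h => hf0 (Subtype.ext h))
    have h2 : psi P m ht G hG0 f = 0 := hf
    rw [h2, hammingNorm_zero] at h1
    push_cast at h1
    linarith
  have hfinrank : Module.finrank k (code P m ht G hG0) =
      Module.finrank k (LinearMap.ker (Phi P m ht G hG0)) := by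
    rw [code, ← LinearMap.range_domRestrict]
    exact LinearMap.finrank_range_of_inj hinj
  have hrank : Module.finrank k G.riemannRoch ≤
      m * n + Module.finrank k (LinearMap.ker (Phi P m ht G hG0)) := by
    rw [← LinearMap.finrank_range_add_finrank_ker (Phi P m ht G hG0)]
    gcongr
    refine (Submodule.finrank_le _).trans_eq ?_
    simp [Module.finrank_pi_fintype, mul_comm]
  refine ⟨?_, ?_⟩
  · rw [hfinrank]
    have : (Module.finrank k G.riemannRoch : ℤ) ≤
      m * n + Module.finrank k (LinearMap.ker (Phi P m ht G hG0)) := by exact_mod_cast hrank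
    linarith
  · have hlt : m * n < Module.finrank k G.riemannRoch := by
      rw [Module.natCard_eq_pow_finrank (K := k) (V := G.riemannRoch)] at hcard
      exact (Nat.pow_lt_pow_iff_right Finite.one_lt_card).mp hcard
    -- The code is nonzero, so that its minimum distance is not the infimum of the empty set.
    have hnontrivial : (code P m ht G hG0 : Set (Fin n → k)).Nontrivial := by
      rw [Set.nontrivial_coe_sort.symm]
      exact Module.nontrivial_of_finrank_pos (R := k) (M := code P m ht G hG0) (by omega)
    obtain ⟨x, hx, y, hy, hxy, hd⟩ := exists_hammingDist_eq_minDist hnontrivial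
    obtain ⟨f, hf, hfxy⟩ := sub_mem hy hx
    have hf0 : f ≠ 0 := by
      rintro rfl
      exact hxy (sub_eq_zero.mp (by rw [← hfxy, map_zero])).symm
    have := le_hammingNorm_psi ht hG0 hG hf hf0
    rwa [hfxy, ← neg_add_eq_sub x y, ← hammingDist_eq_hammingNorm, hd] at this
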